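/- Let $X$ be a complex Banach space. A spectral measure $E$ on $X$ assigns to each Borel set $\delta\subseteq\mathbb C$ a bounded linear operator $E(\delta)$ on $X$ such that $E(\emptyset)=0$, $E(\mathbb C)=I$, $E(\delta\cap\sigma)=E(\delta)E(\sigma)$ for all Borel $\delta,\sigma$, and $E(\bigcup_n\delta_n)x=\sum_n E(\delta_n)x$ for all $x\in X$ and all pairwise disjoint Borel sets $\delta_1,\delta_2,\dots$ A densely defined closed linear operator $A$ in $X$ with domain $D(A)$ is a scalar type spectral operator with spectral measure $E_A$ if $E_A$ is a spectral measure on $X$ such that, for all Borel $\delta\subseteq\mathbb C$, * $E_A(\delta)X\subseteq D(A)$ if $\delta$ is bounded; * $E_A(\delta)D(A)\subseteq D(A)$ and $AE_A(\delta)x=E_A(\delta)Ax$ for all $x\in D(A)$; * the spectrum of the restriction of $A$ to $E_A(\delta)X$ is contained in $\overline\delta$; and $A=\int_{\mathbb C}\lambda\,dE_A(\lambda)$, which means that $x\in D(A)$ if and only if $\lim_{n\to\infty}\int_{\{|\lambda|\le n\}}\lambda\,dE_A(\lambda)x$ exists, and that then $Ax$ is this limit. Here the integral of a bounded Borel function is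 the limit in operator norm of the integrals $\sum_k z_kE_A(\delta_k)$ of Borel simple functions $\sum_k z_k\chi_{\delta_k}$ that converge to it uniformly. The resolvent set $\rho(B)$ of a linear operator $B$ in $X$ consists of the $c\in\mathbb C$ (the regular points of $B$) for which $B-cI:D(B)\to X$ has a bounded inverse defined on all of $X$, and $\sigma(B)=\mathbb C\setminus\rho(B)$. Write $\ker B$ and $R(B)$ for the kernel and the range of $B$. **Corollary 3.2.** Let $A$ be a scalar type spectral operator in $X$ with spectral measure $E_A$, and suppose that $0$ is a regular point of $A$ or an isolated point of $\sigma(A)$. Then $$X=\ker A\oplus R(A),$$ where $\ker A=E_A(\{0\})X$ and $R(A)=E_A(\sigma(A)\setminus\{0\})X$ are closed subspaces of $X$, and the operator $A+E_A(\{0\})$, with domain $D(A)$, has a bounded inverse defined on all of $X$, i.e., $0\in\rho(A+E_A(\{0\}))$. Thus $A$ is reducibly invertible: $A$ is closed, $X=\ker A\oplus R(A)$, and there is a bounded projection $P$ onto $\ker A$ along $R(A)$ such that $A+P$ has a bounded inverse defined on all of $X$. -/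

import Mathlib

open Filter Topology MeasureTheory

noncomputable section

namespace SpectralOp

/-! ### Unbounded linear operators

An operator in `X` with domain `D(A) ⊆ X` is a `LinearPMap`, written `X →ₗ.[ℂ] X`. -/

section Unbounded

variable {X : Type*} [NormedAddCommGroup X] [NormedSpace ℂ X]

/-- The kernel `{x ∈ D(A) | A x = 0}`, a subspace of `X`. -/
def kernel (A : X →ₗ.[ℂ] X) : Submodule ℂ X :=
  (LinearMap.ker A.toFun).map A.domain.subtype

/-- The range `{A x | x ∈ D(A)}`, a subspace of `X`. -/
def range (A : X →ₗ.[ℂ] X) : Submodule ℂ X :=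
  LinearMap.range A.toFun

/-- The resolvent set: `A - c I : D(A) → X` has a bounded inverse `R` defined on all of `X`. -/
def resolventSet (A : X →ₗ.[ℂ] X) : Set ℂ :=
  {c | ∃ R : X →L[ℂ] X,
    (∀ x : A.domain, R (A x - c • (x : X)) = x) ∧
    (∀ y : X, ∃ x : A.domain, (x : X) = R y ∧ A x - c • (x : X) = y)}

/-- The spectrum, i.e. the complement of the resolvent set. -/
def spectrum (A : X →ₗ.[ℂ] X) : Set ℂ := (resolventSet A)ᶜ

/-- The restriction of `A` to the subspace `p`, as an operator in the normed space `p`: its graph is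
the part of the graph of `A` lying in `p × p`. If `A` maps `D(A) ∩ p` into `p`, then its domain is
`D(A) ∩ p`. -/
def restriction (A : X →ₗ.[ℂ] X) (p : Submodule ℂ X) : p →ₗ.[ℂ] p where
  domain :=
    { carrier := {x | ∃ h : (x : X) ∈ A.domain, A ⟨x, h⟩ ∈ p}
      zero_mem' := ⟨A.domain.zero_mem, by
        have h : (⟨((0 : p) : X), A.domain.zero_mem⟩ : A.domain) = 0 := rfl
        rw [h, A.map_zero]; exact p.zero_mem⟩
      add_mem' := by
        rintro x y ⟨hx, hx'⟩ ⟨hy, hy'⟩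
        refine ⟨A.domain.add_mem hx hy, ?_⟩
        have h := A.map_add ⟨x, hx⟩ ⟨y, hy⟩
        exact (show A ⟨_, A.domain.add_mem hx hy⟩ = _ from h) ▸ p.add_mem hx' hy'
      smul_mem' := by
        rintro c x ⟨hx, hx'⟩
        refine ⟨A.domain.smul_mem c hx, ?_⟩
        have h := A.map_smul c ⟨x, hx⟩
        exact (show A ⟨_, A.domain.smul_mem c hx⟩ = _ from h) ▸ p.smul_mem c hx' }
  toFun :=
    { toFun := fun x => ⟨A ⟨(x : p), x.2.1⟩, x.2.2⟩
      map_add' := fun x y => Subtype.ext (A.map_add ⟨(x : p), x.2.1⟩ ⟨(y : p), y.2.1⟩)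
      map_smul' := fun c x => Subtype.ext (A.map_smul c ⟨(x : p), x.2.1⟩) }

/-- A closed operator `A` is reducibly invertible if `X = ker A ⊕ R(A)`, with a bounded projection
`P` onto `ker A` along `R(A)`, and `A + P` has a bounded inverse defined on all of `X`.
(`P +ᵥ A` is Mathlib's sum of an everywhere defined operator and a partially defined one: the
operator `x ↦ P x + A x` with domain `D(A)`.) -/
def IsReduciblyInvertible (A : X →ₗ.[ℂ] X) : Prop :=
  A.IsClosed ∧ IsCompl (kernel A) (range A) ∧
    ∃ P : X →L[ℂ] X, P ∘L P = P ∧ LinearMap.range P.toLinearMap = kernel A ∧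
      LinearMap.ker P.toLinearMap = range A ∧
      (0 : ℂ) ∈ resolventSet (P.toLinearMap +ᵥ A)

end Unbounded

/-! ### Spectral measures and integrals -/

/-- A strongly σ-additive, multiplicative, projection-valued measure on the Borel sets of `ℂ`. The
values at sets that are not Borel are irrelevant. -/
structure SpectralMeasure (X : Type*) [NormedAddCommGroup X] [NormedSpace ℂ X] where
  toFun : Set ℂ → (X →L[ℂ] X)
  map_empty : toFun ∅ = 0
  map_univ : toFun Set.univ = ContinuousLinearMap.id ℂ X
  map_inter : ∀ δ σ : Set ℂ, MeasurableSet δ → MeasurableSet σ →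
    toFun (δ ∩ σ) = toFun δ ∘L toFun σ
  hasSum_iUnion : ∀ δ : ℕ → Set ℂ, (∀ n, MeasurableSet (δ n)) →
    Pairwise (Function.onFun Disjoint δ) →
      ∀ x : X, HasSum (fun n => toFun (δ n) x) (toFun (⋃ n, δ n) x)

variable {X : Type*} [NormedAddCommGroup X] [NormedSpace ℂ X]

instance : CoeFun (SpectralMeasure X) (fun _ => Set ℂ → (X →L[ℂ] X)) := ⟨SpectralMeasure.toFun⟩

namespace SpectralMeasure

/-- `∫ s dE = ∑ z, z E({s = z})` for a Borel simple function `s`. -/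
def simpleIntegral (E : SpectralMeasure X) (s : SimpleFunc ℂ ℂ) : X →L[ℂ] X :=
  ∑ z ∈ s.range, z • E (s ⁻¹' {z})

/-- `T = ∫ F dE` for a bounded Borel function `F`: the operator `T` is the limit, in the operator
norm, of the integrals of simple functions that converge to `F` uniformly. -/
def HasBoundedIntegral (E : SpectralMeasure X) (F : ℂ → ℂ) (T : X →L[ℂ] X) : Prop :=
  ∃ s : ℕ → SimpleFunc ℂ ℂ, TendstoUniformly (fun n z => s n z) F atTop ∧
    Tendsto (fun n => E.simpleIntegral (s n)) atTop (𝓝 T)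

open Classical in
/-- `∫ F dE` for a bounded Borel function `F` (and a junk value for other functions). -/
def boundedIntegral (E : SpectralMeasure X) (F : ℂ → ℂ) : X →L[ℂ] X :=
  if h : ∃ T, E.HasBoundedIntegral F T then h.choose else 0

/-- The function `F χ_{|F| ≤ n}`. -/
def truncate (F : ℂ → ℂ) (n : ℕ) : ℂ → ℂ := Set.indicator {z | ‖F z‖ ≤ n} F

/-- The pairs `(x, y)` such that `(∫ F χ_{|F| ≤ n} dE) x → y` as `n → ∞`. -/
def integralGraph (E : SpectralMeasure X) (F : ℂ → ℂ) : Submodule ℂ (X × X) where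
  carrier := {q | Tendsto (fun n => E.boundedIntegral (truncate F n) q.1) atTop (𝓝 q.2)}
  zero_mem' := by simp
  add_mem' := by
    intro a b ha hb
    simpa using Tendsto.add (show Tendsto _ _ _ from ha) (show Tendsto _ _ _ from hb)
  smul_mem' := by
    intro c a ha
    simpa using Tendsto.const_smul (show Tendsto _ _ _ from ha) c

/-- `∫ F dE` for a Borel function `F`, possibly unbounded: the operator `x ↦ lim (∫ F_n dE) x`,
`F_n = F χ_{|F| ≤ n}`, whose domain is the set of all `x` for which this limit exists. -/
def integral (E : SpectralMeasure X) (F : ℂ → ℂ) : X →ₗ.[ℂ] X :=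
  (E.integralGraph F).toLinearPMap

/-- The graph of `∫ F dE` is the set of pairs used to define it. -/
theorem graph_integral (E : SpectralMeasure X) (F : ℂ → ℂ) :
    (E.integral F).graph = E.integralGraph F := by
  refine Submodule.toLinearPMap_graph_eq _ ?_
  rintro ⟨x, y⟩ hq (rfl : x = 0)
  have h : Tendsto (fun n => E.boundedIntegral (truncate F n) 0) atTop (𝓝 y) := hq
  simp only [map_zero] at h
  exact tendsto_nhds_unique h tendsto_const_nhds

end SpectralMeasure

/-! ### Spectral operators -/

/-- `A` is a spectral operator with spectral measure `E`. -/
structure IsSpectralOperator (A : X →ₗ.[ℂ] X) (E : SpectralMeasure X) : Prop where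
  dense_domain : Dense (A.domain : Set X)
  isClosed : A.IsClosed
  mem_domain_of_isBounded : ∀ δ : Set ℂ, MeasurableSet δ → Bornology.IsBounded δ →
    ∀ x : X, E δ x ∈ A.domain
  commute : ∀ δ : Set ℂ, MeasurableSet δ → ∀ x : A.domain,
    ∃ h : E δ (x : X) ∈ A.domain, A ⟨E δ (x : X), h⟩ = E δ (A x)
  spectrum_restriction : ∀ δ : Set ℂ, MeasurableSet δ →
    spectrum (restriction A (LinearMap.range (E δ).toLinearMap)) ⊆ closure δ

/-- `A` is a scalar type spectral operator with spectral measure `E`: it is spectral and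
`A = ∫ z dE(z)`, domains included. -/
structure IsScalarType (A : X →ₗ.[ℂ] X) (E : SpectralMeasure X) : Prop extends
    IsSpectralOperator A E where
  eq_integral : A = E.integral (fun z => z)

end SpectralOp

end

/-! Since `0` does not accumulate spectrum, some punctured ball about `0` lies in the resolvent set.
Let `δ` be the complement of the ball. Because `E` vanishes on the resolvent set
(`resolventSet_eq_zero`), `E {0} + E δ = 1`, which splits `X` into two closed subspaces reducing
`A`. On the first, `A` is zero, since the truncated integrals of `z` vanish there. On the second,
`A` is boundedly invertible, since `0 ∉ closure δ`. Kernel, range and the inverse of `A + E {0}` are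
read off from this splitting.

The vanishing of `E` is a compactness argument: for compact `K` in the resolvent set, `A` is bounded
on the range of `E K` by the closed graph theorem and has empty spectrum there, so that range is
zero. The resolvent set is open, hence a countable union of such `K`. -/

namespace SpectralOp

/-! ### Resolvent sets of unbounded operators -/

section Unbounded

variable {X : Type*} [NormedAddCommGroup X] [NormedSpace ℂ X]

theorem mem_kernel_iff {A : X →ₗ.[ℂ] X} {x : X} :
    x ∈ kernel A ↔ ∃ h : x ∈ A.domain, A ⟨x, h⟩ = 0 := by
  constructor
  · rintro ⟨y, hy, rfl⟩
    exact ⟨y.2, hy⟩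
  · rintro ⟨h, hx⟩
    exact ⟨⟨x, h⟩, hx, rfl⟩

theorem mem_resolventSet_restriction_iff {A : X →ₗ.[ℂ] X} {p : Submodule ℂ X} {c : ℂ} :
    c ∈ resolventSet (restriction A p) ↔ ∃ R : p →L[ℂ] p,
      (∀ (x : p) (h : (x : X) ∈ A.domain) (hp : A ⟨x, h⟩ ∈ p), R (⟨A ⟨x, h⟩, hp⟩ - c • x) = x) ∧
      (∀ y : p, ∃ h : (R y : X) ∈ A.domain, A ⟨R y, h⟩ - c • (R y : X) = y) := by
  constructor
  · rintro ⟨R, h1, h2⟩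
    refine ⟨R, fun x h hp => h1 ⟨x, h, hp⟩, fun y => ?_⟩
    obtain ⟨⟨x, h, hp⟩, rfl, hx⟩ := h2 y
    exact ⟨h, congrArg Subtype.val hx⟩
  · rintro ⟨R, h1, h2⟩
    refine ⟨R, fun x => h1 x x.2.1 x.2.2, fun y => ?_⟩
    obtain ⟨h, hy⟩ := h2 y
    have hp : A ⟨R y, h⟩ ∈ p := by
      rw [sub_eq_iff_eq_add.1 hy]
      exact p.add_mem y.2 (p.smul_mem c (R y).2)
    exact ⟨⟨R y, h, hp⟩, rfl, Subtype.ext hy⟩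

/-- On the domain, `R (A - d) = 1 - (d - c) R`. The right side is invertible for `d` near `c`, and
its inverse composed with `R` is the resolvent at `d`. -/
theorem isOpen_resolventSet [CompleteSpace X] (A : X →ₗ.[ℂ] X) : IsOpen (resolventSet A) := by
  rw [isOpen_iff_mem_nhds]
  rintro c ⟨R, h1, h2⟩
  have hcont : ContinuousAt (fun d : ℂ => (1 : X →L[ℂ] X) - (d - c) • R) c := by fun_prop
  have hunit : ∀ᶠ d in 𝓝 c, IsUnit ((1 : X →L[ℂ] X) - (d - c) • R) := by
    refine hcont.eventually (p := IsUnit) ?_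
    simp only [sub_self, zero_smul, sub_zero]
    exact Units.nhds (1 : (X →L[ℂ] X)ˣ)
  filter_upwards [hunit] with d hd
  obtain ⟨u, hu⟩ := hd
  have hu' (x : X) : (u : X →L[ℂ] X) x = x - (d - c) • R x := by simp [hu]
  have hl (x : X) : (↑u⁻¹ : X →L[ℂ] X) ((u : X →L[ℂ] X) x) = x := by
    rw [← mul_apply_eq_comp, Units.inv_mul]; rfl
  have hr (x : X) : (u : X →L[ℂ] X) ((↑u⁻¹ : X →L[ℂ] X) x) = x := by
    rw [← mul_apply_eq_comp, Units.mul_inv]; rfl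
  refine ⟨(↑u⁻¹ : X →L[ℂ] X) ∘L R, fun x => ?_, fun y => ?_⟩
  · have h := h1 x
    have : R (A x - d • (x : X)) = (u : X →L[ℂ] X) x := by
      rw [hu', show A x - d • (x : X) = (A x - c • (x : X)) - (d - c) • (x : X) by module,
        map_sub, h, map_smul]
    rw [ContinuousLinearMap.comp_apply, this, hl]
  · obtain ⟨x, hx, hx'⟩ := h2 ((↑u⁻¹ : X →L[ℂ] X) y)
    have hxu : (u : X →L[ℂ] X) x = R y := by
      have hcomm : (u : X →L[ℂ] X) * R = R * u := by rw [hu]; simp [mul_sub, sub_mul]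
      calc (u : X →L[ℂ] X) x = ((u : X →L[ℂ] X) * R) ((↑u⁻¹ : X →L[ℂ] X) y) := by
            rw [hx]; rfl
        _ = R y := by rw [hcomm, mul_apply_eq_comp, hr]
    refine ⟨x, by rw [ContinuousLinearMap.comp_apply, ← hxu, hl], ?_⟩
    have h := hr y
    rw [← hx', hu', hx'] at h
    rw [← h, ← hx, ← hx']
    module

end Unbounded

variable {X : Type*} [NormedAddCommGroup X] [NormedSpace ℂ X]

/-! ### Null sets and integrals on atoms -/

namespace SpectralMeasure

variable (E : SpectralMeasure X)

theorem apply_apply {δ σ : Set ℂ} (hδ : MeasurableSet δ) (hσ : MeasurableSet σ) (x : X) :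
    E δ (E σ x) = E (δ ∩ σ) x := by
  rw [E.map_inter δ σ hδ hσ]; rfl

theorem mem_range_iff {δ : Set ℂ} (hδ : MeasurableSet δ) {x : X} :
    x ∈ LinearMap.range (E δ).toLinearMap ↔ E δ x = x := by
  constructor
  · rintro ⟨y, rfl⟩
    simpa using E.apply_apply hδ hδ y
  · exact fun h => ⟨x, h⟩

theorem isClosed_range {δ : Set ℂ} (hδ : MeasurableSet δ) :
    IsClosed (LinearMap.range (E δ).toLinearMap : Set X) := by
  have : (LinearMap.range (E δ).toLinearMap : Set X) = {x | E δ x = x} :=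
    Set.ext fun x => E.mem_range_iff hδ
  rw [this]
  exact isClosed_eq (E δ).continuous continuous_id

theorem map_union {δ σ : Set ℂ} (hδ : MeasurableSet δ) (hσ : MeasurableSet σ)
    (h : Disjoint δ σ) : E (δ ∪ σ) = E δ + E σ := by
  ext x
  let f : ℕ → Set ℂ := fun n => if n = 0 then δ else if n = 1 then σ else ∅
  have hm (n : ℕ) : MeasurableSet (f n) := by
    simp only [f]; split_ifs <;> simp [hδ, hσ]
  have hd : Pairwise (Function.onFun Disjoint f) := by
    intro m n hmn
    simp only [Function.onFun, f]
    split_ifs <;> first | omega | simp [h.symm]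
  have hU : ⋃ n, f n = δ ∪ σ := by
    apply subset_antisymm
    · refine Set.iUnion_subset fun n => ?_
      simp only [f]; split_ifs <;> simp
    · exact Set.union_subset (Set.subset_iUnion f 0) (Set.subset_iUnion f 1)
  have h1 := E.hasSum_iUnion f hm hd x
  have h2 : HasSum (fun n => E (f n) x) (∑ n ∈ Finset.range 2, E (f n) x) := by
    refine hasSum_sum_of_ne_finset_zero fun n hn => ?_
    have : f n = ∅ := by
      simp only [Finset.mem_range] at hn
      simp only [f]; rw [if_neg (by omega), if_neg (by omega)]
    rw [this, E.map_empty]; rfl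
  rw [hU] at h1
  simpa [Finset.sum_range_succ, f] using h1.unique h2

theorem eq_zero_of_subset {δ σ : Set ℂ} (hδ : MeasurableSet δ) (hσ : MeasurableSet σ)
    (h : δ ⊆ σ) (h0 : E σ = 0) : E δ = 0 := by
  rw [← Set.inter_eq_left.2 h, E.map_inter δ σ hδ hσ, h0, ContinuousLinearMap.comp_zero]

theorem iUnion_eq_zero {δ : ℕ → Set ℂ} (hδ : ∀ n, MeasurableSet (δ n)) (h0 : ∀ n, E (δ n) = 0) :
    E (⋃ n, δ n) = 0 := by
  ext x
  have h := E.hasSum_iUnion (disjointed δ) (fun n => MeasurableSet.disjointed hδ n)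
    (disjoint_disjointed δ) x
  rw [iUnion_disjointed] at h
  rw [zero_apply]
  refine h.unique ?_
  convert hasSum_zero (α := X) (β := ℕ) with n
  rw [E.eq_zero_of_subset (MeasurableSet.disjointed hδ n) (hδ n) (disjointed_subset δ n) (h0 n),
    zero_apply]

theorem eq_of_subset {δ σ : Set ℂ} (hδ : MeasurableSet δ) (hσ : MeasurableSet σ)
    (h : δ ⊆ σ) (h0 : E (σ \ δ) = 0) : E δ = E σ := by
  have := E.map_union hδ (hσ.diff hδ) Set.disjoint_sdiff_right
  rw [Set.union_sdiff_cancel h, h0, add_zero] at this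
  exact this.symm

theorem simpleIntegral_comp_singleton (s : SimpleFunc ℂ ℂ) (c : ℂ) (x : X) :
    E.simpleIntegral s (E {c} x) = s c • E {c} x := by
  have hm := measurableSet_singleton c
  rw [simpleIntegral, sum_apply, Finset.sum_eq_single (s c)]
  · rw [smul_apply, E.apply_apply (s.measurableSet_preimage _) hm,
      Set.inter_eq_right.2 (by simp)]
  · intro z _ hz
    have : s ⁻¹' {z} ∩ {c} = ∅ := by
      ext w
      simp only [Set.mem_inter_iff, Set.mem_preimage, Set.mem_singleton_iff,
        Set.mem_empty_iff_false, iff_false, not_and]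
      rintro h rfl
      exact hz h.symm
    rw [smul_apply, E.apply_apply (s.measurableSet_preimage _) hm, this,
      E.map_empty, zero_apply, smul_zero]
  · exact fun h => absurd (s.mem_range_self c) h

theorem HasBoundedIntegral.apply_singleton {E : SpectralMeasure X} {F : ℂ → ℂ} {T : X →L[ℂ] X}
    (hT : E.HasBoundedIntegral F T) (c : ℂ) (x : X) : T (E {c} x) = F c • E {c} x := by
  obtain ⟨s, hs, hsT⟩ := hT
  have h1 : Tendsto (fun n => E.simpleIntegral (s n) (E {c} x)) atTop (𝓝 (T (E {c} x))) :=
    ((ContinuousLinearMap.apply ℂ X (E {c} x)).continuous.tendsto T).comp hsT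
  simp only [simpleIntegral_comp_singleton] at h1
  exact tendsto_nhds_unique h1 ((hs.tendsto_at c).smul_const _)

/-- The default value of the integral is `0` as well, so existence of the integral need not be
established. -/
theorem boundedIntegral_apply_singleton_eq_zero {F : ℂ → ℂ} {c : ℂ} (hF : F c = 0) (x : X) :
    E.boundedIntegral F (E {c} x) = 0 := by
  rw [boundedIntegral]
  split_ifs with h
  · rw [h.choose_spec.apply_singleton, hF, zero_smul]
  · rfl

end SpectralMeasure

variable {A : X →ₗ.[ℂ] X} {E : SpectralMeasure X}

/-- This is where the integral formula for `A` enters; a general spectral operator may have a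
nonzero quasinilpotent part on this subspace. -/
theorem IsScalarType.range_singleton_le_kernel (hA : IsScalarType A E) :
    LinearMap.range (E {0}).toLinearMap ≤ kernel A := by
  rintro _ ⟨x, rfl⟩
  have hg : (E {0} x, (0 : X)) ∈ A.graph := by
    rw [hA.eq_integral, SpectralMeasure.graph_integral]
    refine tendsto_const_nhds.congr fun n => Eq.symm ?_
    exact E.boundedIntegral_apply_singleton_eq_zero
      (by simp [SpectralMeasure.truncate]) x
  obtain ⟨y, hy, hy'⟩ := (LinearPMap.mem_graph_iff A).1 hg
  exact ⟨y, hy', hy⟩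

/-! ### Support of the spectral measure -/

namespace IsSpectralOperator

/-- If the restriction of `A` to the range of `E δ` is regular at `0`, then `A` is injective there. -/
theorem apply_eq_zero_of_mem_kernel (hA : IsSpectralOperator A E) {δ : Set ℂ}
    (hδ : MeasurableSet δ) (h0 : (0 : ℂ) ∉ closure δ) {x : X} (hx : x ∈ kernel A) :
    E δ x = 0 := by
  obtain ⟨R, h1, -⟩ := mem_resolventSet_restriction_iff.1
    (not_not.1 fun h => h0 (hA.spectrum_restriction δ hδ h))
  obtain ⟨hx, hx0⟩ := mem_kernel_iff.1 hx
  obtain ⟨h, hE⟩ := hA.commute δ hδ ⟨x, hx⟩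
  rw [hx0, map_zero] at hE
  have h2 := h1 ⟨E δ x, x, rfl⟩ h (hE ▸ Submodule.zero_mem _)
  have h3 : (⟨A ⟨E δ x, h⟩, hE ▸ Submodule.zero_mem _⟩ :
      LinearMap.range (E δ).toLinearMap) = 0 := Subtype.ext hE
  rw [h3, zero_smul, sub_zero, map_zero] at h2
  exact (congrArg Subtype.val h2).symm

/-- The resolvent of `A` commutes with `E δ`, so it leaves the range of `E δ` invariant. -/
theorem resolventSet_subset_restriction (hA : IsSpectralOperator A E) {δ : Set ℂ}
    (hδ : MeasurableSet δ) :
    resolventSet A ⊆ resolventSet (restriction A (LinearMap.range (E δ).toLinearMap)) := by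
  rintro c ⟨R, h1, h2⟩
  have hcomm (y : X) : E δ (R y) = R (E δ y) := by
    obtain ⟨x, hx, rfl⟩ := h2 y
    obtain ⟨h, hE⟩ := hA.commute δ hδ x
    rw [← hx, map_sub, map_smul, ← hE]
    exact (h1 ⟨_, h⟩).symm
  set p := LinearMap.range (E δ).toLinearMap
  have hR (y : p) : R y ∈ p :=
    (E.mem_range_iff hδ).2 (by rw [hcomm, (E.mem_range_iff hδ).1 y.2])
  refine mem_resolventSet_restriction_iff.2
    ⟨(R ∘L p.subtypeL).codRestrict p hR, fun x h _ => Subtype.ext (h1 ⟨x, h⟩), fun y => ?_⟩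
  obtain ⟨x, hx, hx'⟩ := h2 y
  have h : R y ∈ A.domain := hx ▸ x.2
  have hxe : x = ⟨R y, h⟩ := Subtype.ext hx
  subst hxe
  exact ⟨h, hx'⟩

/-- A compact subset of the resolvent set is a null set of the spectral measure. -/
theorem eq_zero_of_isCompact [CompleteSpace X] (hA : IsSpectralOperator A E) {K : Set ℂ}
    (hK : IsCompact K) (hKA : K ⊆ resolventSet A) : E K = 0 := by
  have hm := hK.measurableSet
  -- Points of `K` are regular already for `A`; points off `K` are regular because `closure K = K`.
  have hres (c : ℂ) :
      c ∈ resolventSet (restriction A (LinearMap.range (E K).toLinearMap)) := by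
    by_cases hc : c ∈ K
    · exact hA.resolventSet_subset_restriction hm (hKA hc)
    · by_contra h
      exact hc (hK.isClosed.closure_eq ▸ hA.spectrum_restriction K hm h)
  set p := LinearMap.range (E K).toLinearMap
  have hEp (x : p) : E K x = x := (E.mem_range_iff hm).1 x.2
  -- Boundedness of `K` makes the restriction everywhere defined.
  have hdom (x : p) : (x : X) ∈ A.domain := hEp x ▸ hA.mem_domain_of_isBounded K hm hK.isBounded x
  have hmap (x : p) : A ⟨x, hdom x⟩ ∈ p := by
    obtain ⟨h, hE⟩ := hA.commute K hm ⟨x, hdom x⟩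
    refine (E.mem_range_iff hm).2 (hE.symm.trans ?_)
    congr 1
    exact Subtype.ext (hEp x)
  let T₀ : p →ₗ[ℂ] p :=
    { toFun := fun x => ⟨A ⟨x, hdom x⟩, hmap x⟩
      map_add' := fun x y => Subtype.ext (A.map_add ⟨x, hdom x⟩ ⟨y, hdom y⟩)
      map_smul' := fun c x => Subtype.ext (A.map_smul c ⟨x, hdom x⟩) }
  have : CompleteSpace p := (E.isClosed_range hm).completeSpace_coe
  have hclosed : IsClosed (T₀.graph : Set (p × p)) := by
    have : (T₀.graph : Set (p × p)) =
        (fun q : p × p => ((q.1 : X), (q.2 : X))) ⁻¹' (A.graph : Set (X × X)) := by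
      ext ⟨x, y⟩
      simp only [SetLike.mem_coe, LinearMap.mem_graph_iff, Set.mem_preimage,
        LinearPMap.mem_graph_iff]
      constructor
      · rintro rfl
        exact ⟨⟨x, hdom x⟩, rfl, rfl⟩
      · rintro ⟨⟨z, hz⟩, hzx, hy⟩
        obtain rfl : z = x := hzx
        exact Subtype.ext hy.symm
    rw [this]
    exact IsClosed.preimage (by fun_prop) hA.isClosed
  let T : p →L[ℂ] p := ⟨T₀, T₀.continuous_of_isClosed_graph hclosed⟩
  have hT (x : p) : T x = ⟨A ⟨x, hdom x⟩, hmap x⟩ := rfl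
  have hspec : _root_.spectrum ℂ T = ∅ := by
    refine Set.eq_empty_of_forall_notMem fun c hc => hc ?_
    obtain ⟨R, h1, h2⟩ := mem_resolventSet_restriction_iff.1 (hres c)
    have hl : R * (T - algebraMap ℂ _ c) = 1 := by
      ext1 x
      simpa [Algebra.algebraMap_eq_smul_one, hT] using h1 x (hdom x) (hmap x)
    have hr : (T - algebraMap ℂ _ c) * R = 1 := by
      ext1 y
      obtain ⟨h, hy⟩ := h2 y
      refine Subtype.ext ?_
      simpa [Algebra.algebraMap_eq_smul_one, hT] using hy
    have hu : IsUnit (T - algebraMap ℂ _ c) := ⟨⟨_, R, hr, hl⟩, rfl⟩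
    have := hu.neg
    rwa [neg_sub] at this
  -- A bounded operator on a nonzero complex Banach space has nonempty spectrum.
  have hsub : Subsingleton p := by
    by_contra h
    have : Nontrivial p := not_subsingleton_iff_nontrivial.1 h
    have := spectrum.nonempty T
    rw [hspec] at this
    exact Set.not_nonempty_empty this
  ext x
  exact congrArg Subtype.val (Subsingleton.elim (⟨E K x, x, rfl⟩ : p) 0)

/-- The spectral measure of a spectral operator is supported on the spectrum. -/
theorem resolventSet_eq_zero [CompleteSpace X] (hA : IsSpectralOperator A E) :
    E (resolventSet A) = 0 := by
  -- An open set is a countable union of closed sets; intersecting these with closed balls gives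
  -- compact ones.
  obtain ⟨F, hF, hFU, hU, -⟩ := (isOpen_resolventSet A).exists_iUnion_isClosed
  have hK (q : ℕ) : E (⋃ n, F n ∩ Metric.closedBall 0 q) = 0 := by
    refine E.iUnion_eq_zero (fun n => ((hF n).inter Metric.isClosed_closedBall).measurableSet) ?_
    intro n
    exact hA.eq_zero_of_isCompact ((isCompact_closedBall _ _).inter_left (hF n))
      (Set.inter_subset_left.trans (hFU n))
  have h : E (⋃ q : ℕ, ⋃ n, F n ∩ Metric.closedBall (0 : ℂ) q) = 0 :=
    E.iUnion_eq_zero (fun q => MeasurableSet.iUnion fun n =>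
      ((hF n).inter Metric.isClosed_closedBall).measurableSet) hK
  rw [Set.iUnion_comm] at h
  simp only [← Set.inter_iUnion, Metric.iUnion_closedBall_nat, Set.inter_univ] at h
  rwa [hU] at h

theorem eq_zero_of_subset_resolventSet [CompleteSpace X] (hA : IsSpectralOperator A E) {δ : Set ℂ}
    (hδ : MeasurableSet δ) (h : δ ⊆ resolventSet A) : E δ = 0 :=
  E.eq_zero_of_subset hδ (isOpen_resolventSet A).measurableSet h hA.resolventSet_eq_zero

end IsSpectralOperator

/-- A punctured neighbourhood of `0` consists of regular points. -/
theorem exists_ball_diff_subset_resolventSet [CompleteSpace X] (A : X →ₗ.[ℂ] X)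
    (h0 : (0 : ℂ) ∈ resolventSet A ∨ ∃ U ∈ 𝓝 (0 : ℂ), spectrum A ∩ U = {0}) :
    ∃ r > 0, Metric.ball (0 : ℂ) r \ {0} ⊆ resolventSet A := by
  rcases h0 with h | ⟨U, hU, hUA⟩
  · obtain ⟨r, hr, h⟩ := Metric.mem_nhds_iff.1 ((isOpen_resolventSet A).mem_nhds h)
    exact ⟨r, hr, Set.sdiff_subset.trans h⟩
  · obtain ⟨r, hr, h⟩ := Metric.mem_nhds_iff.1 hU
    refine ⟨r, hr, fun z hz => ?_⟩
    by_contra hzA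
    exact hz.2 (hUA ▸ (⟨hzA, h hz.1⟩ : z ∈ spectrum A ∩ U))

/-! ### Kernel, range and inverse from a splitting `E {0} + E δ = 1` -/

namespace IsScalarType

variable {δ : Set ℂ}

theorem kernel_eq (hA : IsScalarType A E) (hδ : MeasurableSet δ) (h0 : (0 : ℂ) ∉ closure δ)
    (hsum : ∀ x, E {0} x + E δ x = x) : kernel A = LinearMap.range (E {0}).toLinearMap := by
  refine le_antisymm (fun x hx => ?_) hA.range_singleton_le_kernel
  refine ⟨x, ?_⟩
  have := hsum x
  rwa [hA.apply_eq_zero_of_mem_kernel hδ h0 hx, add_zero] at this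

theorem range_le (hA : IsScalarType A E) (hsum : ∀ x, E {0} x + E δ x = x) :
    range A ≤ LinearMap.range (E δ).toLinearMap := by
  rintro _ ⟨x, rfl⟩
  obtain ⟨h, hE⟩ := hA.commute {0} (measurableSet_singleton 0) x
  obtain ⟨_, h0⟩ := mem_kernel_iff.1 (hA.range_singleton_le_kernel ⟨(x : X), rfl⟩)
  have := hsum (A x)
  rw [← hE] at this
  exact ⟨A x, by simpa [show A ⟨E {0} (x : X), h⟩ = 0 from h0] using this⟩

theorem range_eq (hA : IsScalarType A E) (hδ : MeasurableSet δ) (h0 : (0 : ℂ) ∉ closure δ)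
    (hsum : ∀ x, E {0} x + E δ x = x) : range A = LinearMap.range (E δ).toLinearMap := by
  refine le_antisymm (hA.range_le hsum) fun y hy => ?_
  obtain ⟨R, -, h2⟩ := mem_resolventSet_restriction_iff.1
    (not_not.1 fun h => h0 (hA.spectrum_restriction δ hδ h))
  obtain ⟨h, hR⟩ := h2 ⟨y, hy⟩
  exact ⟨⟨_, h⟩, by simpa using hR⟩

theorem zero_mem_resolventSet_vadd (hA : IsScalarType A E) (hδ : MeasurableSet δ)
    (h0 : (0 : ℂ) ∉ closure δ) (hsum : ∀ x, E {0} x + E δ x = x) :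
    (0 : ℂ) ∈ resolventSet ((E {0}).toLinearMap +ᵥ A) := by
  have hm := measurableSet_singleton (0 : ℂ)
  have hdisj : E ({0} ∩ δ) = 0 := by
    rw [Set.singleton_inter_eq_empty.2 fun h => h0 (subset_closure h), E.map_empty]
  have hPQ (x : X) : E {0} (E δ x) = 0 := by
    rw [E.apply_apply hm hδ, hdisj]; rfl
  have hQP (x : X) : E δ (E {0} x) = 0 := by
    rw [E.apply_apply hδ hm, Set.inter_comm, hdisj]; rfl
  have hPP (x : X) : E {0} (E {0} x) = E {0} x := by
    rw [E.apply_apply hm hm, Set.inter_self]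
  have hPA (x : A.domain) : E {0} (A x) = 0 := by
    obtain ⟨y, hy⟩ := hA.range_le hsum ⟨x, rfl⟩
    have hy : E δ y = A x := hy
    rw [← hy, hPQ]
  obtain ⟨R, h1, h2⟩ := mem_resolventSet_restriction_iff.1
    (not_not.1 fun h => h0 (hA.spectrum_restriction δ hδ h))
  let Q := (E δ).codRestrict (LinearMap.range (E δ).toLinearMap) fun x => ⟨x, rfl⟩
  -- The inverse is `R` on the range of `E δ` and the identity on the range of `E {0}`.
  refine ⟨(LinearMap.range (E δ).toLinearMap).subtypeL ∘L R ∘L Q + E {0}, ?_, fun y => ?_⟩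
  · intro x
    let x' : A.domain := ⟨x, x.2⟩
    obtain ⟨h, hE⟩ := hA.commute δ hδ x'
    have hQ : Q (E {0} (x' : X) + A x') = ⟨A ⟨E δ (x' : X), h⟩, hE ▸ ⟨A x', rfl⟩⟩ :=
      Subtype.ext (by simp [Q, hQP, hE])
    have hR := h1 ⟨E δ (x' : X), (x' : X), rfl⟩ h (hE ▸ ⟨A x', rfl⟩)
    rw [zero_smul, sub_zero, ← hQ] at hR
    rw [zero_smul, sub_zero]
    change ((R (Q (E {0} (x' : X) + A x')) : _) : X) + E {0} (E {0} (x' : X) + A x') = x'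
    rw [hR, map_add, hPP, hPA, add_zero, add_comm]
    exact hsum x'
  · obtain ⟨h, hR⟩ := h2 (Q y)
    obtain ⟨k, hk⟩ := mem_kernel_iff.1 (hA.range_singleton_le_kernel ⟨y, rfl⟩)
    have hz : E {0} ((R (Q y) : _) : X) = 0 := by
      obtain ⟨w, hw⟩ := (R (Q y)).2
      have hw : E δ w = R (Q y) := hw
      rw [← hw, hPQ]
    refine ⟨⟨(R (Q y) : X) + E {0} y, A.domain.add_mem h k⟩, rfl, ?_⟩
    have hadd : A ⟨(R (Q y) : X) + E {0} y, A.domain.add_mem h k⟩ = E δ y := by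
      have := A.map_add ⟨_, h⟩ ⟨_, k⟩
      rw [hk, add_zero, sub_eq_iff_eq_add.1 hR, zero_smul, add_zero] at this
      exact this
    rw [zero_smul, sub_zero]
    change E {0} ((R (Q y) : X) + E {0} y) + A ⟨(R (Q y) : X) + E {0} y, A.domain.add_mem h k⟩ = y
    rw [hadd, map_add, hz, hPP, zero_add, hsum]

end IsScalarType

end SpectralOp

theorem corollary3p2 {X : Type*} [NormedAddCommGroup X] [NormedSpace ℂ X] [CompleteSpace X]
    (A : X →ₗ.[ℂ] X) (E : SpectralOp.SpectralMeasure X) (hA : SpectralOp.IsScalarType A E)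
    (h0 : (0 : ℂ) ∈ SpectralOp.resolventSet A ∨
      ∃ U ∈ 𝓝 (0 : ℂ), SpectralOp.spectrum A ∩ U = {0}) :
    IsCompl (SpectralOp.kernel A) (SpectralOp.range A) ∧
    IsClosed (SpectralOp.kernel A : Set X) ∧
    IsClosed (SpectralOp.range A : Set X) ∧
    SpectralOp.kernel A = LinearMap.range (E {0}).toLinearMap ∧
    SpectralOp.range A = LinearMap.range (E (SpectralOp.spectrum A \ {0})).toLinearMap ∧
    (0 : ℂ) ∈ SpectralOp.resolventSet ((E {0}).toLinearMap +ᵥ A) ∧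
    SpectralOp.IsReduciblyInvertible A := by

  obtain ⟨r, hr, hrA⟩ := SpectralOp.exists_ball_diff_subset_resolventSet A h0
  let δ : Set ℂ := (Metric.ball 0 r)ᶜ
  have hδc : IsClosed δ := Metric.isOpen_ball.isClosed_compl
  have hδ : MeasurableSet δ := hδc.measurableSet
  have h0δ : (0 : ℂ) ∉ closure δ := by rw [hδc.closure_eq]; simp [δ, hr]
  have hm := measurableSet_singleton (0 : ℂ)
  have hsum (x : X) : E {0} x + E δ x = x := by
    have hd : Disjoint {0} δ := Set.disjoint_singleton_left.2 fun h => h0δ (subset_closure h)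
    -- The complement of `{0} ∪ δ` is the punctured ball, a null set.
    have h := E.eq_of_subset (hm.union hδ) MeasurableSet.univ (Set.subset_univ _)
      (hA.eq_zero_of_subset_resolventSet (MeasurableSet.univ.diff (hm.union hδ)) fun z hz => hrA
        ⟨not_not.1 fun h => hz.2 (Or.inr h), fun h => hz.2 (Or.inl h)⟩)
    rw [E.map_union hm hδ hd, E.map_univ] at h
    exact DFunLike.congr_fun h x
  have hσ : MeasurableSet (SpectralOp.spectrum A \ {0}) :=
    (SpectralOp.isOpen_resolventSet A).measurableSet.compl.diff hm
  -- The two sets differ only by regular points of `A`.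
  have hEσ : E (SpectralOp.spectrum A \ {0}) = E δ := by
    refine E.eq_of_subset hσ hδ (fun z hz hzr => hz.1 (hrA ⟨hzr, hz.2⟩)) ?_
    refine hA.eq_zero_of_subset_resolventSet (hδ.diff hσ) fun z hz => ?_
    by_contra h
    refine hz.2 ⟨h, fun hz0 => h0δ (subset_closure ?_)⟩
    rw [← Set.mem_singleton_iff.1 hz0]
    exact hz.1
  have hker := hA.kernel_eq hδ h0δ hsum
  have hran := hA.range_eq hδ h0δ hsum
  have hinv := hA.zero_mem_resolventSet_vadd hδ h0δ hsum
  have hPP : E {0} ∘L E {0} = E {0} := by rw [← E.map_inter _ _ hm hm, Set.inter_self]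
  have hkerP : LinearMap.ker (E {0}).toLinearMap = SpectralOp.range A := by
    rw [hran]
    ext x
    rw [E.mem_range_iff hδ, LinearMap.mem_ker]
    have := hsum x
    constructor
    · intro h
      rwa [show E {0} x = 0 from h, zero_add] at this
    · intro h
      rw [h] at this
      exact add_eq_right.1 this
  have hcompl : IsCompl (SpectralOp.kernel A) (SpectralOp.range A) := by
    rw [hker, ← hkerP]
    exact (LinearMap.IsIdempotentElem.isCompl
      (congrArg ContinuousLinearMap.toLinearMap hPP))
  refine ⟨hcompl, hker ▸ E.isClosed_range hm, hran ▸ E.isClosed_range hδ, hker, ?_, hinv,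
    hA.isClosed, hcompl, E {0}, hPP, hker.symm, hkerP, hinv⟩
  rw [hEσ, hran]
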